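/- Let $K$ be a field and $S=K[x_1,\dots,x_n]$ the standard graded polynomial ring with $\mathfrak m=(x_1,\dots,x_n)$. For a nonzero graded ideal $I\subset S$ let $\alpha(I)=\min\{d : (I/\mathfrak m I)_d\neq 0\}$ be its initial degree. For a proper graded ideal $I\subset S$ and $\mathfrak p\in\operatorname{Ass}(I)$ let $\mathrm v_{\mathfrak p}(I)$ be the least degree of a homogeneous polynomial $f\in S$ with $(I:f)=\mathfrak p$, and let $\mathrm v(I)=\min_{\mathfrak p\in\operatorname{Ass}(I)}\mathrm v_{\mathfrak p}(I)$. Let $\operatorname{v\text{-}stab}(I)$ be the smallest $k_0\ge 1$ such that $\mathrm v(I^k)=ak+b$ for all $k\ge k_0$, where $k\mapsto ak+b$ is the linear function that agrees with $\mathrm v(I^k)$ for all $k\gg 0$. The support of a monomial ideal is the set of variables dividing at least one of its minimal monomial generators. Let $t\ge 1$ and let $I_1,\dots,I_t\subset S$ be nonzero proper monomial ideals with pairwise disjoint supports. Suppose that, for each $j=1,\dots,t$, $\mathrm v(I_j^k)=\alpha(I_j)k-1$ for all $k\gg 0$. Then, for all $k\ge 1$, $$ \mathrm v\Big(\big(\textstyle\sum_{j=1}^t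 I_j\big)^k\Big)\ \ge\ \Big(\min_{1\le j\le t}\alpha(I_j)\Big)k+\Big(\sum_{j=1}^t\alpha(I_j)-\min_{1\le j\le t}\alpha(I_j)-t\Big). $$ Moreover: - if $\alpha(I_1)=\alpha(I_2)=\cdots=\alpha(I_t)$, then equality holds for all $k\gg 0$; - if $\operatorname{v\text{-}stab}(I_1)=\cdots=\operatorname{v\text{-}stab}(I_t)=1$, then equality holds for all $k\ge 1$. -/

import Mathlib

noncomputable section

namespace VNumber

open MvPolynomial

variable {K : Type*} [Field K] {n : ℕ}

/-- A monomial ideal of `K[x_1,…,x_n]`: an ideal generated by monomials. -/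
def IsMonomialIdeal (I : Ideal (MvPolynomial (Fin n) K)) : Prop :=
  ∃ A : Set (Fin n →₀ ℕ), I = Ideal.span ((fun a => monomial a (1 : K)) '' A)

/-- Exponents of the minimal monomial generators `𝒢(I)` of a monomial ideal `I`: the monomials of
`I` that are minimal with respect to divisibility. -/
def minGens (I : Ideal (MvPolynomial (Fin n) K)) : Set (Fin n →₀ ℕ) :=
  {a | Minimal (fun b => monomial b (1 : K) ∈ I) a}

/-- The support of a monomial ideal: the (indices of the) variables that divide at least one of
its minimal monomial generators. -/
def supp (I : Ideal (MvPolynomial (Fin n) K)) : Set (Fin n) :=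
  ⋃ a ∈ minGens I, (a.support : Set (Fin n))

/-- The initial degree `α(I) = min {d : (I/𝔪I)_d ≠ 0}` of a nonzero graded ideal, where
`𝔪 = (x_1,…,x_n)`: the least degree of a homogeneous element of `I` that is not in `𝔪I`. -/
def initialDegree (I : Ideal (MvPolynomial (Fin n) K)) : ℕ :=
  sInf {d : ℕ | ∃ f ∈ I, f.IsHomogeneous d ∧ f ∉ idealOfVars (Fin n) K * I}

/-- The local number `v_𝔭(I)`: the least degree of a homogeneous polynomial `f` with
`(I : f) = 𝔭`. (Such an `f` exists if `I` is graded and `𝔭 ∈ Ass(I)`.) -/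
def localVNumber (I p : Ideal (MvPolynomial (Fin n) K)) : ℕ :=
  sInf {d : ℕ | ∃ f : MvPolynomial (Fin n) K, f.IsHomogeneous d ∧ I.colon {f} = p}

/-- `v(I) = min {v_𝔭(I) : 𝔭 ∈ Ass(I)}` for a proper graded ideal `I`. As the polynomial ring is
Noetherian, `Submodule.associatedPrimes I` consists of the prime ideals of the form `(I : f)`
(`Submodule.isAssociatedPrime_iff`); it is nonempty because `I` is proper. -/
def vNumber (I : Ideal (MvPolynomial (Fin n) K)) : ℕ :=
  sInf {d : ℕ | ∃ p ∈ Submodule.associatedPrimes I, localVNumber I p = d}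

/-- The `v`-stability index: the smallest `k₀ ≥ 1` such that `v(I^k) = a k + b` for all `k ≥ k₀`,
where `k ↦ a k + b` is the linear function that agrees with `v(I^k)` for all large `k`. (Two
linear functions that agree for all large `k` are equal, so that quantifying over `a` and `b`
singles out this function.) -/
def vStab (I : Ideal (MvPolynomial (Fin n) K)) : ℕ :=
  sInf {k₀ : ℕ | 1 ≤ k₀ ∧ ∃ a b : ℤ, ∀ k : ℕ, k₀ ≤ k → (vNumber (I ^ k) : ℤ) = a * k + b}

end VNumber

end

namespace VNumber

open MvPolynomial

/-! ### Monomial ideals: membership, products, powers, sums -/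

section MonomialIdeals

variable {σ K : Type*} [Field K] {n : ℕ}

/-! Write J = ∑ I_j and α_j = α(I_j), and let u_j be the part of a monomial u in the variables of
I_j. The v-number of a monomial ideal is attained by a monomial (`exists_colon_monomial_eq`), and
disjoint supports decouple membership: u ∈ J^k iff u_j ∈ I_j^{c_j} for some c with ∑ c_j = k.

Lower bound (`le_vNumber_iSup_pow`): let (J^k : u) be prime, a_j the largest power of I_j containing
u_j, and e = k - 1 - ∑ a_j ≥ 0. The prime contains a variable x of each I_j, and x changes only u_j,
so x u_j ∈ I_j^{a_j+e+1} and deg u_j + 1 ≥ α_j (a_j+e+1). Sum over j.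

Upper bound (`vNumber_iSup_pow_le`): if ∑ r_j = k - 1, the product of optimal monomials for the
I_j^{r_j+1} has as colon a prime generated by variables, so v(J^k) ≤ ∑ v(I_j^{r_j+1}). Putting
nonzero r_j only where α_j is minimal makes the bounds meet. -/

theorem monomial_mem_of_le {I : Ideal (MvPolynomial σ K)} {a b : σ →₀ ℕ}
    (ha : monomial a (1 : K) ∈ I) (hab : a ≤ b) : monomial b (1 : K) ∈ I := by
  have h : monomial b (1 : K) = monomial (b - a) 1 * monomial a 1 := by
    rw [monomial_mul, one_mul, tsub_add_cancel_of_le hab]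
  rw [h]
  exact I.mul_mem_left _ ha

theorem IsMonomialIdeal.mem_iff {I : Ideal (MvPolynomial (Fin n) K)} (hI : IsMonomialIdeal I)
    {f : MvPolynomial (Fin n) K} :
    f ∈ I ↔ ∀ a ∈ f.support, monomial a (1 : K) ∈ I := by
  obtain ⟨A, rfl⟩ := hI
  rw [mem_ideal_span_monomial_image]
  refine forall₂_congr fun a _ => ?_
  rw [mem_ideal_span_monomial_image]
  simp

theorem span_monomial_mul_span_monomial (A B : Set (Fin n →₀ ℕ)) :
    Ideal.span ((fun a => monomial a (1 : K)) '' A) *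
      Ideal.span ((fun a => monomial a (1 : K)) '' B) =
      Ideal.span ((fun a => monomial a (1 : K)) '' Set.image2 (· + ·) A B) := by
  rw [Ideal.span_mul_span', ← Set.image2_mul, Set.image2_image_left, Set.image2_image_right,
    Set.image_image2]
  simp [monomial_mul]

theorem IsMonomialIdeal.mul {I J : Ideal (MvPolynomial (Fin n) K)} (hI : IsMonomialIdeal I)
    (hJ : IsMonomialIdeal J) : IsMonomialIdeal (I * J) := by
  obtain ⟨A, rfl⟩ := hI
  obtain ⟨B, rfl⟩ := hJ
  exact ⟨_, span_monomial_mul_span_monomial A B⟩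

theorem isMonomialIdeal_top : IsMonomialIdeal (⊤ : Ideal (MvPolynomial (Fin n) K)) := by
  refine ⟨{0}, ?_⟩
  rw [Set.image_singleton, monomial_zero', C_1, Ideal.span_singleton_one]

theorem isMonomialIdeal_idealOfVars : IsMonomialIdeal (idealOfVars (Fin n) K) := by
  refine ⟨Set.range fun i => Finsupp.single i 1, ?_⟩
  rw [← Set.range_comp]
  rfl

theorem IsMonomialIdeal.pow {I : Ideal (MvPolynomial (Fin n) K)} (hI : IsMonomialIdeal I)
    (k : ℕ) : IsMonomialIdeal (I ^ k) := by
  induction k with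
  | zero => rw [pow_zero, Ideal.one_eq_top]; exact isMonomialIdeal_top
  | succ k ih => rw [pow_succ]; exact ih.mul hI

theorem IsMonomialIdeal.iSup {ι : Type*} {I : ι → Ideal (MvPolynomial (Fin n) K)}
    (hI : ∀ j, IsMonomialIdeal (I j)) : IsMonomialIdeal (⨆ j, I j) := by
  choose A hA using hI
  refine ⟨⋃ j, A j, ?_⟩
  rw [Set.image_iUnion, Ideal.span_iUnion]
  exact iSup_congr hA

theorem monomial_mem_mul {I J : Ideal (MvPolynomial (Fin n) K)} (hI : IsMonomialIdeal I)
    (hJ : IsMonomialIdeal J) {c : Fin n →₀ ℕ} (hc : monomial c (1 : K) ∈ I * J) :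
    ∃ a b, monomial a (1 : K) ∈ I ∧ monomial b (1 : K) ∈ J ∧ a + b = c := by
  obtain ⟨A, rfl⟩ := hI
  obtain ⟨B, rfl⟩ := hJ
  rw [span_monomial_mul_span_monomial, mem_ideal_span_monomial_image] at hc
  obtain ⟨_, ⟨a, ha, b, hb, rfl⟩, hle⟩ := hc c (by simp)
  refine ⟨a, c - a, Ideal.subset_span ⟨a, ha, rfl⟩, ?_, ?_⟩
  · refine monomial_mem_of_le (Ideal.subset_span ⟨b, hb, rfl⟩) ?_
    exact le_tsub_of_add_le_left hle
  · exact add_tsub_cancel_of_le (le_self_add.trans hle)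

theorem monomial_mem_iSup {ι : Type*} {I : ι → Ideal (MvPolynomial (Fin n) K)}
    (hI : ∀ j, IsMonomialIdeal (I j)) {a : Fin n →₀ ℕ} (ha : monomial a (1 : K) ∈ ⨆ j, I j) :
    ∃ j, monomial a (1 : K) ∈ I j := by
  choose A hA using hI
  have h : ⨆ j, I j = Ideal.span ((fun a => monomial a (1 : K)) '' ⋃ j, A j) := by
    rw [Set.image_iUnion, Ideal.span_iUnion]
    exact iSup_congr hA
  rw [h, mem_ideal_span_monomial_image] at ha
  obtain ⟨b, hb, hle⟩ := ha a (by simp)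
  obtain ⟨j, hj⟩ := Set.mem_iUnion.1 hb
  refine ⟨j, monomial_mem_of_le ?_ hle⟩
  rw [hA j]
  exact Ideal.subset_span ⟨b, hj, rfl⟩

theorem monomial_pow_mem_add {I : Ideal (MvPolynomial σ K)} {k l : ℕ} {a b : σ →₀ ℕ}
    (ha : monomial a (1 : K) ∈ I ^ k) (hb : monomial b (1 : K) ∈ I ^ l) :
    monomial (a + b) (1 : K) ∈ I ^ (k + l) := by
  have h := Ideal.mul_mem_mul ha hb
  rwa [monomial_mul, one_mul, ← pow_add] at h

end MonomialIdeals

/-! ### Prime colon ideals and monomial witnesses of the v-number -/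

section Colon

/-- The ideal is the kernel of the substitution sending the variables in `s` to zero, and the target
is a domain. -/
theorem isPrime_span_X_image {σ R : Type*} [CommRing R] [IsDomain R] (s : Set σ) :
    (Ideal.span (X '' s) : Ideal (MvPolynomial σ R)).IsPrime := by
  classical
  set φ : MvPolynomial σ R →ₐ[R] MvPolynomial σ R := aeval fun i => if i ∈ s then 0 else X i
  set p : Ideal (MvPolynomial σ R) := Ideal.span (X '' s)
  have hφ : (Ideal.Quotient.mkₐ R p).comp φ = Ideal.Quotient.mkₐ R p := by
    ext i
    by_cases hi : i ∈ s
    · have : Ideal.Quotient.mk p (X i) = 0 :=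
        Ideal.Quotient.eq_zero_iff_mem.2 (Ideal.subset_span ⟨i, hi, rfl⟩)
      simp [φ, hi, this]
    · simp [φ, hi]
  have hker : p = RingHom.ker φ := by
    refine le_antisymm (Ideal.span_le.2 ?_) fun f hf => ?_
    · rintro _ ⟨i, hi, rfl⟩
      simp [φ, hi]
    · rw [← Ideal.Quotient.eq_zero_iff_mem]
      have := DFunLike.congr_fun hφ f
      rw [AlgHom.comp_apply, (RingHom.mem_ker).1 hf, map_zero] at this
      exact this.symm
  rw [hker]
  exact RingHom.ker_isPrime _

variable {K : Type*} [Field K] {n : ℕ} {I p : Ideal (MvPolynomial (Fin n) K)}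

theorem IsMonomialIdeal.mem_colon_monomial (hI : IsMonomialIdeal I) {u : Fin n →₀ ℕ}
    {g : MvPolynomial (Fin n) K} :
    g ∈ I.colon {monomial u (1 : K)} ↔ ∀ a ∈ g.support, monomial (a + u) (1 : K) ∈ I := by
  rw [Submodule.mem_colon_singleton, smul_eq_mul, hI.mem_iff]
  constructor
  · intro h a ha
    refine h _ ?_
    rw [mem_support_iff, coeff_mul_monomial, mul_one]
    exact mem_support_iff.1 ha
  · intro h b hb
    rw [mem_support_iff, coeff_mul_monomial'] at hb
    split_ifs at hb with hle
    · have := h (b - u) (mem_support_iff.2 (by simpa using hb))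
      rwa [tsub_add_cancel_of_le hle] at this
    · exact absurd rfl hb

theorem colon_sub_of_mem {f g : MvPolynomial (Fin n) K} (hg : g ∈ I) :
    I.colon {f - g} = I.colon {f} := by
  ext h
  rw [Submodule.mem_colon_singleton, Submodule.mem_colon_singleton, smul_sub]
  exact Submodule.sub_mem_iff_left _ (I.mul_mem_left _ hg)

theorem card_support_sub_monomial_lt {σ R : Type*} [CommRing R] {f : MvPolynomial σ R}
    {a : σ →₀ ℕ} (ha : a ∈ f.support) :
    (f - monomial a (f.coeff a)).support.card < f.support.card := by
  classical
  refine Finset.card_lt_card ((Finset.ssubset_iff_of_subset ?_).2 ⟨a, ha, ?_⟩)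
  · intro b hb
    rw [mem_support_iff, coeff_sub, coeff_monomial] at hb
    rw [mem_support_iff]
    intro h0
    split_ifs at hb with hab
    · subst hab; simp at hb
    · simp [h0] at hb
  · rw [notMem_support_iff, coeff_sub, coeff_monomial, if_pos rfl, sub_self]

/-- Let x^a, x^b be the leading monomials of `g`, `f`, so x^{a+b} ∈ I. If x^a ∉ p, replacing `f` by
x^a f keeps the colon, as p is prime; then deleting the x^{a+b} term keeps it too, and leaves fewer
terms. Induct on their number. -/
theorem IsMonomialIdeal.leadingMonomial_mem_of_colon (hI : IsMonomialIdeal I) (hp : p.IsPrime)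
    {f g : MvPolynomial (Fin n) K} (hf : I.colon {f} = p) (hg : g ∈ p) (hg0 : g ≠ 0) :
    monomial (MonomialOrder.lex.degree g) (1 : K) ∈ p := by
  induction hN : f.support.card using Nat.strong_induction_on generalizing f with
  | _ N ih =>
  subst hN
  by_contra hnot
  set a := MonomialOrder.lex.degree g with ha
  have hf0 : f ≠ 0 := by
    rintro rfl
    exact hp.ne_top (by rw [← hf, Submodule.colon_singleton_zero])
  set b := MonomialOrder.lex.degree f with hb
  have hmem : monomial (a + b) (1 : K) ∈ I := by
    have hgf : g * f ∈ I := by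
      rw [← hf, Submodule.mem_colon_singleton] at hg
      exact hg
    refine hI.mem_iff.1 hgf _ ?_
    rw [ha, hb, ← MonomialOrder.degree_mul hg0 hf0]
    exact MonomialOrder.degree_mem_support (mul_ne_zero hg0 hf0)
  set f₁ := monomial a (1 : K) * f with hf₁
  have hcoeff (c : Fin n →₀ ℕ) : f₁.coeff (a + c) = f.coeff c := by
    rw [hf₁, coeff_monomial_mul, one_mul]
  have hcolon : I.colon {f₁} = p := by
    ext h
    have h1 : h ∈ I.colon {f₁} ↔ h * monomial a (1 : K) ∈ p := by
      rw [← hf, Submodule.mem_colon_singleton, Submodule.mem_colon_singleton, hf₁, smul_eq_mul,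
        smul_eq_mul, mul_assoc]
    rw [h1]
    exact ⟨fun h => (hp.mem_or_mem h).resolve_right hnot, fun h => p.mul_mem_right _ h⟩
  have hcard : f₁.support.card ≤ f.support.card := by
    have hsub : f₁.support ⊆ f.support.map (addLeftEmbedding a) := by
      intro c hc
      rw [mem_support_iff, hf₁, coeff_monomial_mul'] at hc
      split_ifs at hc with hle
      · rw [Finset.mem_map]
        refine ⟨c - a, mem_support_iff.2 (by simpa using hc), ?_⟩
        exact add_tsub_cancel_of_le hle
      · exact absurd rfl hc
    exact (Finset.card_le_card hsub).trans (Finset.card_map _).le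
  have hab : a + b ∈ f₁.support := by
    rw [mem_support_iff, hcoeff]
    exact mem_support_iff.1 (MonomialOrder.degree_mem_support hf0)
  refine hnot (ih _ ((card_support_sub_monomial_lt hab).trans_le hcard) ?_ rfl)
  rw [colon_sub_of_mem, hcolon]
  rw [← mul_one (f₁.coeff (a + b)), ← C_mul_monomial]
  exact I.mul_mem_left _ hmem

theorem IsMonomialIdeal.monomial_mem_of_colon (hI : IsMonomialIdeal I) (hp : p.IsPrime)
    {f g : MvPolynomial (Fin n) K} (hf : I.colon {f} = p) (hg : g ∈ p) {a : Fin n →₀ ℕ}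
    (ha : a ∈ g.support) : monomial a (1 : K) ∈ p := by
  induction hN : g.support.card using Nat.strong_induction_on generalizing g with
  | _ N ih =>
  subst hN
  have hg0 : g ≠ 0 := by
    rintro rfl
    simp at ha
  have hlead := hI.leadingMonomial_mem_of_colon hp hf hg hg0
  by_cases hab : a = MonomialOrder.lex.degree g
  · rwa [hab]
  have hdeg := MonomialOrder.degree_mem_support (m := MonomialOrder.lex) hg0
  refine ih _ (card_support_sub_monomial_lt hdeg) (p.sub_mem hg ?_) ?_ rfl
  · rw [← mul_one (g.coeff _), ← C_mul_monomial]
    exact p.mul_mem_left _ hlead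
  · classical
    rw [mem_support_iff, coeff_sub, coeff_monomial, if_neg (Ne.symm hab), sub_zero]
    exact mem_support_iff.1 ha

/-- The colons of the monomials of `f` intersect inside (I : f) = p, so the prime p contains one of
them. Conversely p is a monomial ideal, and a monomial multiplying `f` into I multiplies every term
of `f` into I. -/
theorem IsMonomialIdeal.exists_colon_monomial_eq (hI : IsMonomialIdeal I) (hp : p.IsPrime)
    {f : MvPolynomial (Fin n) K} (hf : I.colon {f} = p) :
    ∃ u ∈ f.support, I.colon {monomial u (1 : K)} = p := by
  have hle : f.support.inf (fun u => I.colon {monomial u (1 : K)}) ≤ p := by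
    intro g hg
    rw [Submodule.mem_finsetInf] at hg
    rw [← hf, Submodule.mem_colon_singleton, smul_eq_mul, f.as_sum, Finset.mul_sum]
    refine I.sum_mem fun u hu => ?_
    have := hg u hu
    rw [Submodule.mem_colon_singleton, smul_eq_mul] at this
    rw [← mul_one (f.coeff u), ← C_mul_monomial, mul_left_comm]
    exact I.mul_mem_left _ this
  obtain ⟨u, hu, hup⟩ := hp.inf_le'.1 hle
  refine ⟨u, hu, le_antisymm hup fun g hg => hI.mem_colon_monomial.2 fun a ha => ?_⟩
  have h := hI.monomial_mem_of_colon hp hf hg ha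
  rw [← hf, Submodule.mem_colon_singleton, smul_eq_mul] at h
  refine hI.mem_iff.1 h _ ?_
  rw [mem_support_iff, coeff_monomial_mul, one_mul]
  exact mem_support_iff.1 hu

theorem exists_isPrime_colon {R : Type*} [CommRing R] [IsNoetherianRing R] {I : Ideal R}
    (hI : I ≠ ⊤) : ∃ f, (I.colon {f}).IsPrime := by
  have : Nontrivial (R ⧸ I) := Ideal.Quotient.nontrivial_iff.2 hI
  obtain ⟨P, hP, -⟩ := exists_le_isAssociatedPrime_of_isNoetherianRing R (1 : R ⧸ I) one_ne_zero
  obtain ⟨hprime, y, rfl⟩ := isAssociatedPrime_iff.1 hP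
  obtain ⟨f, rfl⟩ := Ideal.Quotient.mk_surjective y
  refine ⟨f, ?_⟩
  convert hprime using 1
  ext g
  rw [Submodule.mem_colon_singleton, Submodule.mem_colon_singleton, Submodule.mem_bot,
    smul_eq_mul, ← Ideal.Quotient.eq_zero_iff_mem, map_mul]
  rfl

theorem IsMonomialIdeal.exists_degree_eq_vNumber (hI : IsMonomialIdeal I) (hI' : I ≠ ⊤) :
    ∃ u : Fin n →₀ ℕ, u.degree = vNumber I ∧ (I.colon {monomial u (1 : K)}).IsPrime := by
  obtain ⟨f, hf⟩ := exists_isPrime_colon hI'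
  have hne : {d : ℕ | ∃ p ∈ Submodule.associatedPrimes I, localVNumber I p = d}.Nonempty :=
    ⟨_, I.colon {f}, Submodule.isAssociatedPrime_iff.2 ⟨hf, f, rfl⟩, rfl⟩
  obtain ⟨p, hp, hpv⟩ := Nat.sInf_mem hne
  obtain ⟨hprime, g, hg⟩ := Submodule.isAssociatedPrime_iff.1 hp
  obtain ⟨w, -, hw⟩ := hI.exists_colon_monomial_eq hprime hg.symm
  have hne' : {d : ℕ | ∃ f : MvPolynomial (Fin n) K,
      f.IsHomogeneous d ∧ I.colon {f} = p}.Nonempty :=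
    ⟨_, _, isHomogeneous_monomial 1 rfl, hw⟩
  obtain ⟨h, hhom, hh⟩ := Nat.sInf_mem hne'
  obtain ⟨u, hu, hup⟩ := hI.exists_colon_monomial_eq hprime hh
  refine ⟨u, ?_, hup ▸ hprime⟩
  rw [vNumber, ← hpv, localVNumber]
  exact hhom.degree_eq_sum_deg_support hu |>.symm

theorem vNumber_le_degree {u : Fin n →₀ ℕ} (hu : (I.colon {monomial u (1 : K)}).IsPrime) :
    vNumber I ≤ u.degree := by
  have h : vNumber I ≤ localVNumber I (I.colon {monomial u (1 : K)}) :=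
    Nat.sInf_le ⟨_, Submodule.isAssociatedPrime_iff.2 ⟨hu, _, rfl⟩, rfl⟩
  exact h.trans (Nat.sInf_le ⟨_, isHomogeneous_monomial 1 rfl, rfl⟩)

/-- A prime ideal containing a monomial contains one of its variables. -/
theorem exists_mem_support_of_isPrime_colon {u w : Fin n →₀ ℕ}
    (hu : (I.colon {monomial u (1 : K)}).IsPrime) (hw : monomial (w + u) (1 : K) ∈ I) :
    ∃ i ∈ w.support, monomial (Finsupp.single i 1 + u) (1 : K) ∈ I := by
  have key (a : Fin n →₀ ℕ) : monomial a (1 : K) ∈ I.colon {monomial u (1 : K)} ↔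
      monomial (a + u) (1 : K) ∈ I := by
    rw [Submodule.mem_colon_singleton, smul_eq_mul, monomial_mul, one_mul]
  rw [← key, monomial_eq (s := w), C_1, one_mul, Finsupp.prod, hu.prod_mem_iff] at hw
  obtain ⟨i, hi, hmem⟩ := hw
  exact ⟨i, hi, (key _).1 (hu.mem_of_pow_mem _ hmem)⟩

end Colon

/-! ### Restricting exponents to the support of an ideal -/

section Restriction

variable {K : Type*} [Field K] {n : ℕ} {I : Ideal (MvPolynomial (Fin n) K)}

open scoped Classical in
/-- The part of an exponent vector that involves only the variables in `V`. -/
noncomputable def restrict {n : ℕ} (V : Set (Fin n)) : (Fin n →₀ ℕ) →+ (Fin n →₀ ℕ) :=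
  Finsupp.filterAddHom (· ∈ V)

theorem restrict_apply_of_mem {V : Set (Fin n)} {i : Fin n} (hi : i ∈ V) (a : Fin n →₀ ℕ) :
    restrict V a i = a i := by
  classical
  exact Finsupp.filter_apply_pos _ _ hi

theorem restrict_apply_of_notMem {V : Set (Fin n)} {i : Fin n} (hi : i ∉ V) (a : Fin n →₀ ℕ) :
    restrict V a i = 0 := by
  classical
  exact Finsupp.filter_apply_neg _ _ hi

theorem restrict_le (V : Set (Fin n)) (a : Fin n →₀ ℕ) : restrict V a ≤ a := by
  intro i
  by_cases hi : i ∈ V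
  · rw [restrict_apply_of_mem hi]
  · rw [restrict_apply_of_notMem hi]; exact Nat.zero_le _

theorem le_restrict {V : Set (Fin n)} {a b : Fin n →₀ ℕ} (h : a ≤ b)
    (ha : (a.support : Set _) ⊆ V) :
    a ≤ restrict V b := by
  intro i
  by_cases hi : i ∈ V
  · rw [restrict_apply_of_mem hi]; exact h i
  · rw [Finsupp.notMem_support_iff.1 fun h' => hi (ha h')]; exact Nat.zero_le _

theorem restrict_single_of_mem {V : Set (Fin n)} {i : Fin n} (hi : i ∈ V) :
    restrict V (Finsupp.single i 1) = Finsupp.single i 1 := by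
  classical
  exact Finsupp.filter_single_of_pos _ hi

theorem restrict_single_of_notMem {V : Set (Fin n)} {i : Fin n} (hi : i ∉ V) :
    restrict V (Finsupp.single i 1) = 0 := by
  classical
  exact Finsupp.filter_single_of_neg _ hi

theorem restrict_restrict (V : Set (Fin n)) (a : Fin n →₀ ℕ) :
    restrict V (restrict V a) = restrict V a := by
  ext i
  by_cases hi : i ∈ V
  · rw [restrict_apply_of_mem hi]
  · rw [restrict_apply_of_notMem hi, restrict_apply_of_notMem hi]

theorem restrict_restrict_of_disjoint {V W : Set (Fin n)} (h : Disjoint V W) (a : Fin n →₀ ℕ) :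
    restrict V (restrict W a) = 0 := by
  ext i
  by_cases hi : i ∈ V
  · rw [restrict_apply_of_mem hi, restrict_apply_of_notMem (Set.disjoint_left.1 h hi)]
    rfl
  · rw [restrict_apply_of_notMem hi]
    rfl

theorem sum_restrict_le {ι : Type*} [Fintype ι] {V : ι → Set (Fin n)}
    (hV : Pairwise fun i j => Disjoint (V i) (V j)) (a : Fin n →₀ ℕ) :
    ∑ j, restrict (V j) a ≤ a := by
  intro i
  rw [Finsupp.finsetSum_apply]
  by_cases h : ∃ j, i ∈ V j
  · obtain ⟨j, hj⟩ := h
    rw [Finset.sum_eq_single j, restrict_apply_of_mem hj]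
    · intro l _ hl
      exact restrict_apply_of_notMem (Set.disjoint_right.1 (hV hl) hj) a
    · simp
  · rw [Finset.sum_eq_zero fun j _ => restrict_apply_of_notMem (fun hj => h ⟨j, hj⟩) a]
    exact Nat.zero_le _

theorem restrict_sum_restrict {ι : Type*} [Fintype ι] {V : ι → Set (Fin n)}
    (hV : Pairwise fun i j => Disjoint (V i) (V j)) (a : ι → Fin n →₀ ℕ) (j : ι) :
    restrict (V j) (∑ l, restrict (V l) (a l)) = restrict (V j) (a j) := by
  rw [map_sum, Finset.sum_eq_single j, restrict_restrict]
  · intro l _ hl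
    exact restrict_restrict_of_disjoint (hV hl.symm) _
  · simp

theorem exists_le_support_subset_supp {a : Fin n →₀ ℕ} (ha : monomial a (1 : K) ∈ I) :
    ∃ b, Minimal (fun b => monomial b (1 : K) ∈ I) b ∧ b ≤ a ∧
      (b.support : Set (Fin n)) ⊆ supp I := by
  obtain ⟨b, hba, hb⟩ :=
    exists_minimal_le_of_wellFoundedLT (fun b => monomial b (1 : K) ∈ I) a ha
  exact ⟨b, hb, hba, fun i hi => Set.mem_iUnion₂.2 ⟨b, hb, hi⟩⟩

theorem restrict_mem {a : Fin n →₀ ℕ} (ha : monomial a (1 : K) ∈ I) :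
    monomial (restrict (supp I) a) (1 : K) ∈ I := by
  obtain ⟨b, hb, hba, hbs⟩ := exists_le_support_subset_supp ha
  exact monomial_mem_of_le hb.prop (le_restrict hba hbs)

theorem IsMonomialIdeal.restrict_mem_pow (hI : IsMonomialIdeal I) {k : ℕ} {a : Fin n →₀ ℕ}
    (ha : monomial a (1 : K) ∈ I ^ k) : monomial (restrict (supp I) a) (1 : K) ∈ I ^ k := by
  induction k generalizing a with
  | zero => simp
  | succ k ih =>
    rw [pow_succ] at ha ⊢
    obtain ⟨b, c, hb, hc, rfl⟩ := monomial_mem_mul (hI.pow k) hI ha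
    have := Ideal.mul_mem_mul (ih hb) (restrict_mem hc)
    rwa [monomial_mul, one_mul, ← map_add] at this

end Restriction

/-! ### Initial degree and powers -/

section InitialDegree

variable {K : Type*} [Field K] {n : ℕ} {I : Ideal (MvPolynomial (Fin n) K)}

theorem IsMonomialIdeal.initialDegree_le (hI : IsMonomialIdeal I) {a : Fin n →₀ ℕ}
    (ha : monomial a (1 : K) ∈ I) : initialDegree I ≤ a.degree := by
  obtain ⟨b, hb, hba, -⟩ := exists_le_support_subset_supp ha
  refine le_trans (Nat.sInf_le ⟨_, hb.prop, isHomogeneous_monomial 1 rfl, fun h => ?_⟩)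
    (Finsupp.degree_mono hba)
  obtain ⟨c, d, hc, hd, rfl⟩ := monomial_mem_mul isMonomialIdeal_idealOfVars hI h
  -- A minimal generator in 𝔪I has a divisor `d` in I; minimality forces the cofactor to be 1, which
  -- is not in 𝔪.
  have hc0 : c = 0 := by
    have := hb.le_of_le hd le_add_self
    simpa using this
  subst hc0
  rw [idealOfVars, ← Set.image_univ, mem_ideal_span_X_image] at hc
  obtain ⟨i, -, hi⟩ := hc 0 (by simp)
  exact hi rfl

theorem IsMonomialIdeal.initialDegree_mul_le (hI : IsMonomialIdeal I) {k : ℕ} {a : Fin n →₀ ℕ}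
    (ha : monomial a (1 : K) ∈ I ^ k) : initialDegree I * k ≤ a.degree := by
  induction k generalizing a with
  | zero => simp
  | succ k ih =>
    rw [pow_succ] at ha
    obtain ⟨b, c, hb, hc, rfl⟩ := monomial_mem_mul (hI.pow k) hI ha
    rw [mul_add, mul_one, map_add]
    exact add_le_add (ih hb) (hI.initialDegree_le hc)

/-- Dividing a product of k+1 elements of I by a variable spoils at most one factor. -/
theorem IsMonomialIdeal.mem_pow_of_single_add_mem (hI : IsMonomialIdeal I) {k : ℕ} {i : Fin n}
    {a : Fin n →₀ ℕ} (ha : monomial (Finsupp.single i 1 + a) (1 : K) ∈ I ^ (k + 1)) :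
    monomial a (1 : K) ∈ I ^ k := by
  induction k generalizing a with
  | zero => simp
  | succ k ih =>
    rw [pow_succ] at ha
    obtain ⟨b, c, hb, hc, hbc⟩ := monomial_mem_mul (hI.pow _) hI ha
    by_cases hib : b i = 0
    · refine monomial_mem_of_le hb fun l => ?_
      have := DFunLike.congr_fun hbc l
      rw [Finsupp.add_apply, Finsupp.add_apply, Finsupp.single_apply] at this
      split_ifs at this with h
      · subst h; omega
      · omega
    · have hle : Finsupp.single i 1 ≤ b := by
        rw [Finsupp.single_le_iff]
        omega
      obtain ⟨b', rfl⟩ := exists_add_of_le hle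
      rw [add_assoc, add_right_inj] at hbc
      rw [← hbc, pow_succ, ← one_mul (1 : K), ← monomial_mul]
      exact Ideal.mul_mem_mul (ih hb) hc

theorem monomial_zero_notMem (hI : I ≠ ⊤) : monomial 0 (1 : K) ∉ I := by
  intro h
  rw [monomial_zero', C_1] at h
  exact hI ((Ideal.eq_top_iff_one I).2 h)

theorem IsMonomialIdeal.exists_monomial_mem (hI : IsMonomialIdeal I) (hne : I ≠ ⊥) :
    ∃ a : Fin n →₀ ℕ, monomial a (1 : K) ∈ I ∧ (a.support : Set (Fin n)) ⊆ supp I := by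
  obtain ⟨f, hf, hf0⟩ := Submodule.exists_mem_ne_zero_of_ne_bot hne
  obtain ⟨a, ha⟩ := Finset.nonempty_iff_ne_empty.2 (support_eq_empty.not.2 hf0)
  obtain ⟨b, hb, -, hbs⟩ := exists_le_support_subset_supp (hI.mem_iff.1 hf a ha)
  exact ⟨b, hb.prop, hbs⟩

end InitialDegree

/-! ### Sums of ideals with disjoint supports -/

section Sum

variable {K : Type*} [Field K] {n : ℕ} {ι : Type*}
  {I : ι → Ideal (MvPolynomial (Fin n) K)}

theorem exists_restrict_mem_of_mem_iSup_pow [Fintype ι] (hI : ∀ j, IsMonomialIdeal (I j)) {k : ℕ}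
    {a : Fin n →₀ ℕ} (ha : monomial a (1 : K) ∈ (⨆ j, I j) ^ k) :
    ∃ c : ι → ℕ, ∑ j, c j = k ∧
      ∀ j, monomial (restrict (supp (I j)) a) (1 : K) ∈ I j ^ c j := by
  classical
  induction k generalizing a with
  | zero => exact ⟨0, by simp, by simp⟩
  | succ k ih =>
    rw [pow_succ] at ha
    obtain ⟨b, d, hb, hd, rfl⟩ := monomial_mem_mul ((IsMonomialIdeal.iSup hI).pow k)
      (IsMonomialIdeal.iSup hI) ha
    obtain ⟨c, hc, hbc⟩ := ih hb
    obtain ⟨j, hj⟩ := monomial_mem_iSup hI hd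
    refine ⟨c + Pi.single j 1, by simp [Finset.sum_add_distrib, hc], fun l => ?_⟩
    rw [map_add]
    refine monomial_pow_mem_add (hbc l) ?_
    by_cases h : l = j
    · subst h
      rw [Pi.single_eq_same, pow_one]
      exact restrict_mem hj
    · rw [Pi.single_eq_of_ne h, pow_zero, Ideal.one_eq_top]
      trivial

theorem mem_iSup_pow_of_restrict_mem [Fintype ι] {V : ι → Set (Fin n)}
    (hV : Pairwise fun i j => Disjoint (V i) (V j)) {k : ℕ} {a : Fin n →₀ ℕ} {c : ι → ℕ}
    (hc : k ≤ ∑ j, c j) (ha : ∀ j, monomial (restrict (V j) a) (1 : K) ∈ I j ^ c j) :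
    monomial a (1 : K) ∈ (⨆ j, I j) ^ k := by
  refine monomial_mem_of_le (Ideal.pow_le_pow_right hc ?_) (sum_restrict_le hV a)
  rw [monomial_sum_one, ← Finset.prod_pow_eq_pow_sum]
  exact Ideal.prod_mem_prod fun j _ => Ideal.pow_right_mono (le_iSup I j) _ (ha j)

theorem iSup_pow_ne_top (hI : ∀ j, IsMonomialIdeal (I j)) (hproper : ∀ j, I j ≠ ⊤) {k : ℕ}
    (hk : 1 ≤ k) : (⨆ j, I j) ^ k ≠ ⊤ := by
  intro h
  have h1 : monomial 0 (1 : K) ∈ ⨆ j, I j :=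
    Ideal.pow_le_self (n := k) (by omega) (h ▸ Submodule.mem_top)
  obtain ⟨j, hj⟩ := monomial_mem_iSup hI h1
  exact monomial_zero_notMem (hproper j) hj

/-- A prime `((⨆ j, I j) ^ k : u)` contains a variable of the support of each `I j`. -/
theorem exists_mem_supp_single_add_mem (hI : ∀ j, IsMonomialIdeal (I j)) (hne : ∀ j, I j ≠ ⊥)
    {k : ℕ} {u : Fin n →₀ ℕ} (hu : (((⨆ j, I j) ^ k).colon {monomial u (1 : K)}).IsPrime) (j : ι) :
    ∃ i ∈ supp (I j), monomial (Finsupp.single i 1 + u) (1 : K) ∈ (⨆ j, I j) ^ k := by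
  obtain ⟨a, ha, has⟩ := (hI j).exists_monomial_mem (hne j)
  have hmem : monomial (k • a + u) (1 : K) ∈ (⨆ j, I j) ^ k := by
    refine monomial_mem_of_le ?_ le_self_add
    rw [← one_pow (M := K) k, ← monomial_pow]
    exact Ideal.pow_mem_pow (le_iSup I j ha) k
  obtain ⟨i, hi, him⟩ :=
    exists_mem_support_of_isPrime_colon hu hmem
  exact ⟨i, has (Finsupp.support_smul hi), him⟩

theorem le_vNumber_iSup_pow [Fintype ι] (hI : ∀ j, IsMonomialIdeal (I j)) (hne : ∀ j, I j ≠ ⊥)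
    (hproper : ∀ j, I j ≠ ⊤) (hV : Pairwise fun i j => Disjoint (supp (I i)) (supp (I j)))
    [Nonempty ι] {m : ℕ} (hm : ∀ j, m ≤ initialDegree (I j)) {k : ℕ} (hk : 1 ≤ k) :
    m * (k - 1) + ∑ j, initialDegree (I j) ≤ vNumber ((⨆ j, I j) ^ k) + Fintype.card ι := by
  classical
  have hJ := IsMonomialIdeal.iSup hI
  obtain ⟨u, hu, hprime⟩ := (hJ.pow k).exists_degree_eq_vNumber (iSup_pow_ne_top hI hproper hk)
  rw [← hu]
  have hu_mem : monomial u (1 : K) ∉ (⨆ j, I j) ^ k := by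
    intro h
    refine hprime.ne_top ((Submodule.colon_eq_top_iff_subset _).2 ?_)
    rwa [Set.singleton_subset_iff]
  set P : ι → ℕ → Prop := fun j a => monomial (restrict (supp (I j)) u) (1 : K) ∈ I j ^ a
  -- The search bound `k` loses nothing: every exponent compared with `a` is at most `k`.
  set a : ι → ℕ := fun j => Nat.findGreatest (P j) k
  have hPa (j : ι) : P j (a j) := Nat.findGreatest_spec (P := P j) (Nat.zero_le k) (by simp [P])
  have hsum : ∑ j, a j < k := by
    by_contra! h
    exact hu_mem (mem_iSup_pow_of_restrict_mem hV h hPa)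
  obtain ⟨e, he⟩ := Nat.exists_eq_add_of_lt hsum
  have hdeg (j : ι) : initialDegree (I j) * (a j + (e + 1)) ≤
      (restrict (supp (I j)) u).degree + 1 := by
    obtain ⟨i, hi, hmem⟩ := exists_mem_supp_single_add_mem hI hne hprime j
    obtain ⟨c, hc, hcm⟩ := exists_restrict_mem_of_mem_iSup_pow hI hmem
    have hca (l : ι) (hl : l ≠ j) : c l ≤ a l := by
      refine Nat.le_findGreatest ?_ ?_
      · rw [← hc]
        exact Finset.single_le_sum (fun _ _ => Nat.zero_le _) (Finset.mem_univ l)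
      · have := hcm l
        rwa [map_add, restrict_single_of_notMem (Set.disjoint_left.1 (hV hl.symm) hi),
          zero_add] at this
    -- The other exponents cannot exceed `a`, so `c j` absorbs the whole deficit `e + 1`.
    have hj : a j + (e + 1) ≤ c j := by
      have h1 := Finset.add_sum_erase Finset.univ c (Finset.mem_univ j)
      have h2 := Finset.add_sum_erase Finset.univ a (Finset.mem_univ j)
      have h3 : ∑ l ∈ Finset.univ.erase j, c l ≤ ∑ l ∈ Finset.univ.erase j, a l :=
        Finset.sum_le_sum fun l hl => hca l (Finset.ne_of_mem_erase hl)
      omega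
    have h := (hI j).initialDegree_mul_le (hcm j)
    rw [map_add, restrict_single_of_mem hi, map_add, Finsupp.degree_single] at h
    exact (Nat.mul_le_mul_left _ hj).trans (h.trans (add_comm 1 _).le)
  have htot : ∑ j, initialDegree (I j) * (a j + (e + 1)) ≤ u.degree + Fintype.card ι := by
    refine (Finset.sum_le_sum fun j _ => hdeg j).trans ?_
    rw [Finset.sum_add_distrib, ← map_sum, Finset.sum_const, Finset.card_univ, smul_eq_mul, mul_one]
    exact Nat.add_le_add_right (Finsupp.degree_mono (sum_restrict_le hV u)) _
  refine le_trans ?_ htot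
  have h1 : m * ∑ j, a j ≤ ∑ j, initialDegree (I j) * a j := by
    rw [Finset.mul_sum]
    exact Finset.sum_le_sum fun j _ => Nat.mul_le_mul_right _ (hm j)
  have h2 : m ≤ ∑ j, initialDegree (I j) :=
    (hm (Classical.arbitrary ι)).trans
      (Finset.single_le_sum (f := fun j => initialDegree (I j)) (fun _ _ => Nat.zero_le _)
        (Finset.mem_univ _))
  have h3 : ∑ j, initialDegree (I j) * (a j + (e + 1)) =
      ∑ j, initialDegree (I j) * a j + (∑ j, initialDegree (I j)) * e
        + ∑ j, initialDegree (I j) := by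
    rw [Finset.sum_mul, ← Finset.sum_add_distrib, ← Finset.sum_add_distrib]
    exact Finset.sum_congr rfl fun j _ => by ring
  have hk1 : k - 1 = ∑ j, a j + e := by omega
  rw [h3, hk1, mul_add]
  have := Nat.mul_le_mul_right e h2
  omega

theorem vNumber_iSup_pow_le [Fintype ι] (hI : ∀ j, IsMonomialIdeal (I j)) (hne : ∀ j, I j ≠ ⊥)
    (hproper : ∀ j, I j ≠ ⊤) (hV : Pairwise fun i j => Disjoint (supp (I i)) (supp (I j)))
    {k : ℕ} {r : ι → ℕ} (hr : ∑ j, r j + 1 = k) :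
    vNumber ((⨆ j, I j) ^ k) ≤ ∑ j, vNumber (I j ^ (r j + 1)) := by
  classical
  have hJ := IsMonomialIdeal.iSup hI
  have hw (j : ι) : ∃ w : Fin n →₀ ℕ, w.degree = vNumber (I j ^ (r j + 1)) ∧
      ((I j ^ (r j + 1)).colon {monomial w (1 : K)}).IsPrime :=
    ((hI j).pow _).exists_degree_eq_vNumber fun h => hproper j <|
      top_le_iff.1 (h ▸ Ideal.pow_le_self (Nat.succ_ne_zero (r j)))
  choose w hwdeg hwprime using hw
  set u : Fin n →₀ ℕ := ∑ j, restrict (supp (I j)) (w j) with hu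
  have hures (j : ι) : restrict (supp (I j)) u = restrict (supp (I j)) (w j) :=
    restrict_sum_restrict hV w j
  have hudeg : u.degree ≤ ∑ j, vNumber (I j ^ (r j + 1)) := by
    rw [hu, map_sum]
    exact Finset.sum_le_sum fun j _ =>
      (hwdeg j).le.trans' (Finsupp.degree_mono (restrict_le _ _))
  -- The variables that generate the colon ideal of `u`.
  set P : Set (Fin n) := {i | ∃ j, i ∈ supp (I j) ∧
    monomial (Finsupp.single i 1 + restrict (supp (I j)) u) (1 : K) ∈ I j ^ (r j + 1)} with hP
  have hstep (j : ι) (m : Fin n →₀ ℕ)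
      (hm : monomial (restrict (supp (I j)) m + restrict (supp (I j)) u) (1 : K) ∈
        I j ^ (r j + 1)) :
      ∃ i ∈ P, m i ≠ 0 ∧ i ∈ supp (I j) ∧
        monomial (Finsupp.single i 1 + restrict (supp (I j)) u) (1 : K) ∈ I j ^ (r j + 1) := by
    rw [hures] at hm
    obtain ⟨i, hi, him⟩ := exists_mem_support_of_isPrime_colon (hwprime j)
      (monomial_mem_of_le hm (add_le_add_right (restrict_le _ (w j)) _))
    have hij : i ∈ supp (I j) := by
      by_contra h
      exact Finsupp.mem_support_iff.1 hi (restrict_apply_of_notMem h m)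
    have him' := (hI j).restrict_mem_pow him
    rw [map_add, restrict_single_of_mem hij, ← hures] at him'
    rw [Finsupp.mem_support_iff, restrict_apply_of_mem hij] at hi
    exact ⟨i, ⟨j, hij, him'⟩, hi, hij, him'⟩
  -- Some variable multiplies u_j into I_j^{r_j+1}, so u_j itself lies in I_j^{r_j}.
  have hpred (j : ι) : monomial (restrict (supp (I j)) u) (1 : K) ∈ I j ^ r j := by
    obtain ⟨a, ha, has⟩ := (hI j).exists_monomial_mem (hne j)
    obtain ⟨i, -, -, -, him⟩ := hstep j ((r j + 1) • a) <| by
      refine monomial_mem_of_le (?_ : monomial (restrict (supp (I j)) ((r j + 1) • a)) (1 : K) ∈ _)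
        le_self_add
      refine (hI j).restrict_mem_pow ?_
      rw [← one_pow (M := K) (r j + 1), ← monomial_pow]
      exact Ideal.pow_mem_pow ha _
    exact (hI j).mem_pow_of_single_add_mem him
  have hcolon : ((⨆ j, I j) ^ k).colon {monomial u (1 : K)} = Ideal.span (X '' P) := by
    ext f
    rw [(hJ.pow k).mem_colon_monomial, mem_ideal_span_X_image]
    refine forall₂_congr fun m _ => ⟨fun h => ?_, ?_⟩
    · obtain ⟨c, hc, hcm⟩ := exists_restrict_mem_of_mem_iSup_pow hI h
      -- Pigeonhole: ∑ c_j = k exceeds ∑ r_j = k - 1.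
      obtain ⟨j, hj⟩ : ∃ j, r j < c j := by
        by_contra! h'
        have := Finset.sum_le_sum fun j (_ : j ∈ Finset.univ) => h' j
        omega
      have := hcm j
      rw [map_add] at this
      obtain ⟨i, hi, him, -⟩ := hstep j m (Ideal.pow_le_pow_right hj this)
      exact ⟨i, hi, him⟩
    · rintro ⟨i, ⟨j, hij, hmem⟩, hmi⟩
      refine mem_iSup_pow_of_restrict_mem hV (c := r + Pi.single j 1) ?_ fun l => ?_
      · simp [Finset.sum_add_distrib, hr]
      · rw [map_add, Pi.add_apply]
        by_cases hl : l = j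
        · subst hl
          rw [Pi.single_eq_same]
          refine monomial_mem_of_le hmem (add_le_add_left ?_ _)
          rw [Finsupp.single_le_iff, restrict_apply_of_mem hij]
          omega
        · rw [Pi.single_eq_of_ne hl, add_zero]
          exact monomial_mem_of_le (hpred l) le_add_self
  refine (vNumber_le_degree ?_).trans hudeg
  rw [hcolon]
  exact isPrime_span_X_image P

end Sum

end VNumber

/-! ### Choice of the exponents r_j and conclusion -/

theorem theorem5p2 {K : Type*} [Field K] (n t : ℕ) (ht : 1 ≤ t)
    (I : Fin t → Ideal (MvPolynomial (Fin n) K))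
    (hmon : ∀ j, VNumber.IsMonomialIdeal (I j))
    (hne : ∀ j, I j ≠ ⊥) (hproper : ∀ j, I j ≠ ⊤)
    (hsupp : Pairwise fun i j => Disjoint (VNumber.supp (I i)) (VNumber.supp (I j)))
    (hv : ∀ j, ∀ᶠ k : ℕ in Filter.atTop,
      (VNumber.vNumber (I j ^ k) : ℤ) = (VNumber.initialDegree (I j) : ℤ) * k - 1) :
    (∀ k : ℕ, 1 ≤ k →
      (VNumber.vNumber ((∑ j, I j) ^ k) : ℤ) ≥
        ((⨅ j, VNumber.initialDegree (I j) : ℕ) : ℤ) * k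
          + ((∑ j, (VNumber.initialDegree (I j) : ℤ))
              - ((⨅ j, VNumber.initialDegree (I j) : ℕ) : ℤ) - t)) ∧
    ((∀ i j, VNumber.initialDegree (I i) = VNumber.initialDegree (I j)) →
      ∀ᶠ k : ℕ in Filter.atTop,
        (VNumber.vNumber ((∑ j, I j) ^ k) : ℤ) =
          ((⨅ j, VNumber.initialDegree (I j) : ℕ) : ℤ) * k
            + ((∑ j, (VNumber.initialDegree (I j) : ℤ))
                - ((⨅ j, VNumber.initialDegree (I j) : ℕ) : ℤ) - t)) ∧
    ((∀ j, VNumber.vStab (I j) = 1) →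
      ∀ k : ℕ, 1 ≤ k →
        (VNumber.vNumber ((∑ j, I j) ^ k) : ℤ) =
          ((⨅ j, VNumber.initialDegree (I j) : ℕ) : ℤ) * k
            + ((∑ j, (VNumber.initialDegree (I j) : ℤ))
                - ((⨅ j, VNumber.initialDegree (I j) : ℕ) : ℤ) - t)) := by
  have : Nonempty (Fin t) := ⟨⟨0, ht⟩⟩
  have hJ : ∑ j, I j = ⨆ j, I j := by
    rw [Ideal.sum_eq_sup, Finset.sup_univ_eq_iSup]
  obtain ⟨j₀, hj₀⟩ := exists_eq_ciInf_of_finite (f := fun j => VNumber.initialDegree (I j))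
  have hmin (j : Fin t) :
      ⨅ j, VNumber.initialDegree (I j) ≤ VNumber.initialDegree (I j) :=
    ciInf_le (OrderBot.bddBelow _) j
  rw [hJ]
  generalize hm : ⨅ j, VNumber.initialDegree (I j) = m at hmin hj₀
  have hlower (k : ℕ) (hk : 1 ≤ k) : (m : ℤ) * k
      + ((∑ j, (VNumber.initialDegree (I j) : ℤ)) - m - t) ≤
      (VNumber.vNumber ((⨆ j, I j) ^ k) : ℤ) := by
    have h := VNumber.le_vNumber_iSup_pow hmon hne hproper hsupp hmin hk
    rw [Fintype.card_fin] at h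
    zify [hk] at h
    linarith
  have hupper (k : ℕ) (r : Fin t → ℕ) (hr : ∑ j, r j + 1 = k)
      (hrm : ∀ j, r j ≠ 0 → VNumber.initialDegree (I j) = m)
      (hrv : ∀ j, (VNumber.vNumber (I j ^ (r j + 1)) : ℤ) =
        (VNumber.initialDegree (I j) : ℤ) * (r j + 1 : ℕ) - 1) :
      (VNumber.vNumber ((⨆ j, I j) ^ k) : ℤ) ≤ (m : ℤ) * k
        + ((∑ j, (VNumber.initialDegree (I j) : ℤ)) - m - t) := by
    have h := VNumber.vNumber_iSup_pow_le hmon hne hproper hsupp hr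
    zify at h
    refine h.trans (le_of_eq ?_)
    have hterm (j : Fin t) : (VNumber.vNumber (I j ^ (r j + 1)) : ℤ) =
        m * r j + VNumber.initialDegree (I j) - 1 := by
      rw [hrv j]
      by_cases h0 : r j = 0
      · simp [h0]
      · rw [hrm j h0]
        push_cast
        ring
    rw [Finset.sum_congr rfl fun j _ => hterm j, Finset.sum_sub_distrib, Finset.sum_add_distrib,
      ← Finset.mul_sum, ← hr]
    simp
    ring
  refine ⟨fun k hk => hlower k hk, fun heq => ?_, fun hstab k hk => ?_⟩
  · obtain ⟨N, hN⟩ := Filter.eventually_atTop.1 (Filter.eventually_all.2 hv)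
    filter_upwards [Filter.eventually_ge_atTop (t * N + 1)] with k hk
    refine le_antisymm ?_ (hlower k (by omega))
    -- The base value `N` puts every power in the range where the formula for v(I_j^k) holds; since
    -- all α_j are equal, the remainder may go to any index.
    refine hupper k (fun j => N + if j = j₀ then k - 1 - t * N else 0) ?_ ?_ ?_
    · simp [Finset.sum_add_distrib]
      omega
    · exact fun j _ => (heq j j₀).trans hj₀
    · exact fun j => hN _ (by omega) j
  · have hv' (j : Fin t) (l : ℕ) (hl : 1 ≤ l) : (VNumber.vNumber (I j ^ l) : ℤ) =
        (VNumber.initialDegree (I j) : ℤ) * l - 1 := by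
      -- The value 1 excludes the default `sInf ∅ = 0`, so the infimum is attained.
      have hmem := Nat.sInf_mem (Nat.nonempty_of_sInf_eq_succ (hstab j))
      have hs : VNumber.vStab (I j) = sInf _ := rfl
      rw [← hs, hstab j] at hmem
      obtain ⟨-, a, b, hab⟩ := hmem
      obtain ⟨N, hN⟩ := Filter.eventually_atTop.1 (hv j)
      -- Two consecutive large arguments determine the slope and the intercept.
      have h1 := (hab (N + 1) (by omega)).symm.trans (hN (N + 1) (by omega))
      have h2 := (hab (N + 2) (by omega)).symm.trans (hN (N + 2) (by omega))
      push_cast at h1 h2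
      have ha : a = VNumber.initialDegree (I j) := by linear_combination h2 - h1
      have hb : b = -1 := by
        rw [ha] at h1
        linarith
      rw [hab l hl, ha, hb]
      ring
    refine le_antisymm ?_ (hlower k hk)
    -- All weight goes to an index of minimal α; each other ideal enters with its first power,
    -- contributing α_j - 1.
    refine hupper k (Pi.single j₀ (k - 1)) ?_ ?_ ?_
    · simp
      omega
    · intro j hj
      by_cases h : j = j₀
      · rw [h, hj₀]
      · exact absurd (Pi.single_eq_of_ne h _) hj
    · exact fun j => hv' j _ (by omega)
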